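/- Let $\Gamma$ be a group generated by a finite symmetric set $S$ (that is, $S=S^{-1}$), and let $\Gamma_0\ge\Gamma_1\ge\Gamma_2\ge\cdots$ be a descending chain of subgroups of finite index in $\Gamma$. For a subgroup $K\le\Gamma$ of finite index, let $\mathrm{Sch}(\Gamma/K,S)$ be the Schreier graph of the coset action (vertex set $\Gamma/K$, and an edge from $x$ to $sx$ for each $x\in\Gamma/K$ and $s\in S$), and let $\rho^{+}(\mathrm{Sch}(\Gamma/K,S))$ be its largest nontrivial eigenvalue, i.e. the largest eigenvalue of the Markov operator $(Mf)(x)=\frac1{|S|}\sum_{s\in S}f(sx)$ on the functions $f:\Gamma/K\to\mathbb{R}$ with $\sum_x f(x)=0$ (and $-\infty$ if $K=\Gamma$). Put $$\rho^{+}=\sup_n\rho^{+}(\mathrm{Sch}(\Gamma/\Gamma_n,S)).$$ For a subgroup $H\le\Gamma$ let $$\rho(\Gamma,H,\lambda_S)=\sup_{0\ne f\in\ell^2(H\backslash\Gamma)}\frac{\langle fM_{\lambda_S},f\rangle}{\langle f,f\rangle},\qquad (fM_{\lambda_S})(Hg)=\frac1{|S|}\sum_{s\in S}f(Hgs),$$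 be the relative spectral radius of $H$ with respect to the uniform probability measure $\lambda_S$ on $S$. If $\rho(\Gamma,H,\lambda_S)>\rho^{+}$, then there is a finitely generated subgroup $H'\le H$ such that $(H'\cap\Gamma_n)_n$ has property $(\tau)$ in $H'$; that is, there are a finite symmetric generating set $T$ of $H'$ and $\varepsilon>0$ such that $\rho^{+}(\mathrm{Sch}(H'/(H'\cap\Gamma_n),T))\le 1-\varepsilon$ for all $n$. If, moreover, all the $\Gamma_n$ are normal in $\Gamma$, then for this $H'$ there is $M>0$ such that $|\Gamma:H'\Gamma_n|<M$ for all $n$. -/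

import Mathlib

/-- The Markov (averaging) operator of the uniform probability measure on the finite set `S`,
where every group element `s` moves the points of `X` by `act s`:
`(M f)(x) = (1/|S|) ∑_{s ∈ S} f (act s x)`. -/
noncomputable def markovOp {G X : Type*} (S : Finset G) (act : G → X → X) (f : X → ℝ) : X → ℝ :=
  fun x => (∑ s ∈ S, f (act s x)) / (S.card : ℝ)

/-- The set `H \ G` of right cosets `H g`. -/
abbrev RightCosets {G : Type*} [Group G] (H : Subgroup G) : Type _ :=
  Quotient (QuotientGroup.rightRel H)

/-- Right multiplication on right cosets: `a` sends `H g` to `H g a`. -/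
def rightCosetMul {G : Type*} [Group G] (H : Subgroup G) (a : G) :
    RightCosets H → RightCosets H :=
  Quotient.map (fun g => g * a) (by
    intro g k hgk
    have h : k * g⁻¹ ∈ H := QuotientGroup.rightRel_apply.mp hgk
    refine QuotientGroup.rightRel_apply.mpr ?_
    simpa [mul_assoc] using h)

/-- The relative spectral radius `ρ(G, H, λ_S)`: the supremum of the Rayleigh quotients
`⟨f M, f⟩ / ⟨f, f⟩` over all nonzero `f ∈ ℓ²(H \ G)`, where `M` averages over right
multiplication by the elements of `S`. -/
noncomputable def relSpectralRadius {G : Type*} [Group G] (H : Subgroup G) (S : Finset G) : ℝ :=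
  sSup {r : ℝ | ∃ f : RightCosets H → ℝ, f ≠ 0 ∧ Memℓp f 2 ∧
    r = (∑' x, markovOp S (rightCosetMul H) f x * f x) / ∑' x, f x * f x}

/-- `θ` is a nontrivial eigenvalue of the Schreier graph `Sch(G/K, S)`, `K` of finite index:
the Markov operator of the graph (vertices `G ⧸ K`, an edge from `x` to `s • x` for each `s ∈ S`)
has an eigenfunction with eigenvalue `θ` that is orthogonal to the constants. -/
def IsNontrivialEigenvalue {G : Type*} [Group G] (K : Subgroup G) (S : Finset G) (θ : ℝ) : Prop :=
  ∃ f : G ⧸ K → ℝ, f ≠ 0 ∧ ∑ᶠ x, f x = 0 ∧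
    markovOp S (fun (s : G) (x : G ⧸ K) => s • x) f = θ • f

/-- `ρ⁺(Sch(G/K, S))`, the largest nontrivial eigenvalue of the Schreier graph; it is `-∞` for
the graph with one vertex, which has no nontrivial eigenvalue. -/
noncomputable def rhoPlus {G : Type*} [Group G] (K : Subgroup G) (S : Finset G) : EReal :=
  sSup {t : EReal | ∃ θ : ℝ, IsNontrivialEigenvalue K S θ ∧ t = (θ : EReal)}

/-- The family `(N i)` of finite-index subgroups has property (τ) in `G`: for some finite
symmetric generating set `T` of `G`, the Schreier graphs `Sch(G/N i, T)` have a uniform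
spectral gap. -/
def HasPropertyTau {G : Type*} [Group G] {ι : Type*} (N : ι → Subgroup G) : Prop :=
  (∀ i, (N i).FiniteIndex) ∧
  ∃ T : Finset G, (∀ t ∈ T, t⁻¹ ∈ T) ∧ Subgroup.closure (T : Set G) = ⊤ ∧
    ∃ ε : ℝ, 0 < ε ∧ ∀ i, rhoPlus (N i) T ≤ ((1 - ε : ℝ) : EReal)

/-! Fix a real θ with ρ⁺ < θ < ρ(Γ, H, λ_S), and a nonnegative f, supported on a finite set A of
right cosets of H, whose Rayleigh quotient exceeds θ. The labels in H of the S-edges inside A form a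
finite symmetric set T, and H' is the subgroup generated by T.

Transfer. Let φ ≥ 0 on Γ/Γ_n be almost T-invariant. The function N(y) = ‖(f(c) φ(c.out • y))_c‖₂ on
Γ/Γ_n then has Rayleigh quotient almost that of f, hence above θ. Mean-zero functions have quotient
at most θ, so N, and with it φ, has a large mean: (∑ φ)² ≥ c |Γ/Γ_n| ∑ φ² with c independent of n
(`mul_sum_sq_le_sum_markovOp`, `mul_card_mul_sum_sq_le_sq_sum`). Extension by zero carries this
bound to the orbits H'/(H' ∩ Γ_n).

Amplification. If the gaps of H' tended to zero, positive parts of eigenfunctions would give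
L²-normalised nonnegative almost invariant functions of mean at most √(1/2). With a first such
function fixed, a second one that is invariant enough is nearly independent of it, so the normalised
product is again almost invariant and its mean is nearly at most the product of the means
(`HasAlmostInvariantOfMeanLE.mul`). Iteration pushes the mean below √c, a contradiction.

Index. For normal Γ_n, the transferred bound applied to the constant 1 on the orbit says |Γ : H'Γ_n|
≤ 1/c. -/

open Finset
open scoped BigOperators

/-! ### Markov operators and Rayleigh quotients on finite Schreier graphs -/

section Markov

variable {G : Type*} [Group G] {X : Type*} [Fintype X] [MulAction G X]

theorem sum_smul_eq_sum (g : G) (f : X → ℝ) : ∑ x, f (g • x) = ∑ x, f x :=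
  Equiv.sum_comp (MulAction.toPerm g) f

theorem sum_smul_mul_eq_sum_mul_inv_smul (g : G) (f h : X → ℝ) :
    ∑ x, f (g • x) * h x = ∑ x, f x * h (g⁻¹ • x) := by
  rw [← sum_smul_eq_sum g fun x => f x * h (g⁻¹ • x)]
  simp

theorem sum_markovOp_mul (S : Finset G) (f h : X → ℝ) :
    ∑ x, markovOp S (fun (s : G) (x : X) => s • x) f x * h x
      = (∑ s ∈ S, ∑ x, f (s • x) * h x) / S.card := by
  simp only [markovOp]
  rw [sum_comm, sum_div]
  refine sum_congr rfl fun x _ => ?_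
  rw [← sum_mul]
  ring

theorem sum_markovOp (S : Finset G) (f : X → ℝ) :
    ∑ x, markovOp S (fun (s : G) (x : X) => s • x) f x = (S.card : ℝ) / S.card * ∑ x, f x := by
  have h := sum_markovOp_mul S f fun _ : X => 1
  simp only [mul_one, sum_smul_eq_sum, sum_const, nsmul_eq_mul] at h
  rw [h]
  ring

theorem sum_markovOp_mul_comm (S : Finset G) (hS : ∀ s ∈ S, s⁻¹ ∈ S) (f h : X → ℝ) :
    ∑ x, markovOp S (fun (s : G) (x : X) => s • x) f x * h x
      = ∑ x, f x * markovOp S (fun (s : G) (x : X) => s • x) h x := by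
  simp_rw [mul_comm (f _)]
  rw [sum_markovOp_mul, sum_markovOp_mul]
  congr 1
  refine sum_bij' (fun s _ => s⁻¹) (fun s _ => s⁻¹) hS hS (by simp) (by simp) fun s _ => ?_
  rw [sum_smul_mul_eq_sum_mul_inv_smul]
  exact sum_congr rfl fun x _ => mul_comm _ _

end Markov

/-- The Rayleigh quotient of a symmetric operator on a finite-dimensional space is bounded by any
bound of its eigenvalues. -/
theorem LinearMap.IsSymmetric.inner_apply_self_le {E : Type*} [NormedAddCommGroup E]
    [InnerProductSpace ℝ E] [FiniteDimensional ℝ E] {A : E →ₗ[ℝ] E} (hA : A.IsSymmetric) {θ : ℝ}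
    (hθ : ∀ μ : ℝ, ∀ v : E, v ≠ 0 → A v = μ • v → μ ≤ θ) (v : E) :
    inner ℝ (A v) v ≤ θ * inner ℝ v v := by
  have hn : Module.finrank ℝ E = Module.finrank ℝ E := rfl
  set b := hA.eigenvectorBasis hn
  rw [← b.sum_inner_mul_inner (A v) v, ← b.sum_inner_mul_inner v v, mul_sum]
  refine sum_le_sum fun i _ => ?_
  have hi : A (b i) = hA.eigenvalues hn i • b i := hA.apply_eigenvectorBasis hn i
  have hle := hθ _ _ (b.orthonormal.ne_zero i) hi
  rw [hA v (b i), hi, inner_smul_right, real_inner_comm v (b i)]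
  nlinarith [mul_self_nonneg (inner ℝ v (b i))]

/-- On functions orthogonal to the constants, the Rayleigh quotient of the Markov operator of a
finite Schreier graph is bounded by `ρ⁺`. -/
theorem sum_markovOp_mul_self_le {G : Type*} [Group G] {L : Subgroup G} [Fintype (G ⧸ L)]
    {S : Finset G} (hS : ∀ s ∈ S, s⁻¹ ∈ S) {θ : ℝ} (hθ : rhoPlus L S ≤ (θ : EReal))
    (f : G ⧸ L → ℝ) (hf : ∑ x, f x = 0) :
    ∑ x, markovOp S (fun (s : G) (x : G ⧸ L) => s • x) f x * f x ≤ θ * ∑ x, f x * f x := by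
  set M := markovOp S (fun (s : G) (x : G ⧸ L) => s • x) with hM
  let A : EuclideanSpace ℝ (G ⧸ L) →ₗ[ℝ] EuclideanSpace ℝ (G ⧸ L) :=
    { toFun := fun v => WithLp.toLp 2 (M v)
      map_add' := fun v w => by
        ext x
        simp [hM, markovOp, sum_add_distrib, add_div]
      map_smul' := fun c v => by
        ext x
        simp [hM, markovOp, ← mul_sum, mul_div_assoc] }
  have hAapp : ∀ v x, A v x = M v x := fun v x => rfl
  let W : Submodule ℝ (EuclideanSpace ℝ (G ⧸ L)) :=
    { carrier := {v | ∑ x, v x = 0}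
      add_mem' := fun {v w} hv hw => by
        simp only [Set.mem_ofPred_eq] at hv hw
        simp [sum_add_distrib, hv, hw]
      zero_mem' := by simp
      smul_mem' := fun c v hv => by
        simp only [Set.mem_ofPred_eq] at hv
        simp [← mul_sum, hv] }
  have hW : ∀ v, v ∈ W ↔ ∑ x, v x = 0 := fun v => Iff.rfl
  have hAW : ∀ v ∈ W, A v ∈ W := fun v hv => by
    rw [hW] at hv ⊢
    simp only [hAapp, hM]
    rw [sum_markovOp, hv, mul_zero]
  have hinner : ∀ v w : EuclideanSpace ℝ (G ⧸ L), inner ℝ v w = ∑ x, v x * w x := fun v w => by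
    simp [PiLp.inner_apply, mul_comm]
  have hsymm : (A.restrict hAW).IsSymmetric := fun v w => by
    simp only [Submodule.coe_inner, LinearMap.coe_restrict_apply, hinner, hAapp]
    exact sum_markovOp_mul_comm S hS _ _
  have key := hsymm.inner_apply_self_le (θ := θ) (fun μ v hv hμ => by
    have hmem : IsNontrivialEigenvalue L S μ := by
      refine ⟨fun x => v.1 x, fun h => hv ?_, ?_, ?_⟩
      · ext x
        exact congrFun h x
      · rw [finsum_eq_sum_of_fintype]
        exact (hW _).1 v.2
      · funext x
        have := congrArg (fun u : W => u.1 x) hμ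
        simpa [LinearMap.coe_restrict_apply, hAapp] using this
    have : (μ : EReal) ≤ rhoPlus L S := le_sSup ⟨μ, hmem, rfl⟩
    exact_mod_cast this.trans hθ) ⟨WithLp.toLp 2 f, (hW _).2 hf⟩
  simpa only [Submodule.coe_inner, LinearMap.coe_restrict_apply, hinner, hAapp] using key

/-! ### Averages, and near independence from a finite quotient -/

section Expect

variable {X : Type*} [Fintype X]

theorem expect_abs_mul_le_sqrt (f g : X → ℝ) :
    𝔼 x, |f x * g x| ≤ √(𝔼 x, f x ^ 2) * √(𝔼 x, g x ^ 2) := by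
  rw [← Real.sqrt_mul (expect_nonneg fun _ _ => sq_nonneg _)]
  refine Real.le_sqrt_of_sq_le ?_
  have h := expect_mul_sq_le_sq_mul_sq univ (fun x => |f x|) fun x => |g x|
  simpa only [sq_abs, abs_mul] using h

theorem expect_abs_le_sqrt [Nonempty X] (f : X → ℝ) : 𝔼 x, |f x| ≤ √(𝔼 x, f x ^ 2) := by
  have h := expect_abs_mul_le_sqrt f fun _ => 1
  simpa [Fintype.expect_const] using h

variable {K : Type*} [Group K] [MulAction K X]

theorem expect_smul_eq_expect (g : K) (f : X → ℝ) : 𝔼 x, f (g • x) = 𝔼 x, f x := by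
  simp only [Fintype.expect_eq_sum_div_card, sum_smul_eq_sum]

/-- If `b` is moved little by group elements that act transitively on a quotient `Y` of `X`, then
`b` is nearly independent of every function lifted from `Y`. -/
theorem abs_expect_comp_mul_sub_le {Y : Type*} [Fintype Y] [Nonempty Y] [Nonempty X]
    [MulAction K Y] (p : X → Y)
    (hp : ∀ (k : K) x, p (k • x) = k • p x) (b : X → ℝ) (η : ℝ)
    (h : ∀ y y' : Y, ∃ k : K, k • y = y' ∧ 𝔼 x, |b (k • x) - b x| ≤ η) (g : Y → ℝ) :
    |𝔼 x, g (p x) * b x - (𝔼 y, g y) * 𝔼 x, b x| ≤ (∑ y, |g y|) * η := by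
  classical
  -- The share of the fibre over y in the mean of b, normalised by |X| and not by the fibre. An
  -- element k moves fibres to fibres, so small displacement of b makes β nearly constant.
  set β : Y → ℝ := fun y => 𝔼 x, if p x = y then b x else 0 with hβ
  have hosc : ∀ y y', |β y - β y'| ≤ η := by
    intro y y'
    obtain ⟨k, rfl, hk⟩ := h y y'
    have e : β (k • y) = 𝔼 x, if p x = y then b (k • x) else 0 := by
      rw [hβ]
      simp only
      rw [← expect_smul_eq_expect k]
      simp only [hp, smul_left_cancel_iff]
    rw [e, abs_sub_comm, hβ, ← expect_sub_distrib]
    refine (abs_expect_le _ _).trans (le_trans (expect_le_expect fun x _ => ?_) hk)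
    split_ifs <;> simp
  have hsum : ∀ g : Y → ℝ, 𝔼 x, g (p x) * b x = ∑ y, g y * β y := by
    intro g
    simp only [hβ, mul_expect]
    rw [← expect_sum_comm]
    refine expect_congr rfl fun x _ => ?_
    simp
  have hb : 𝔼 x, b x = ∑ y, β y := by simpa using hsum fun _ => 1
  have hav : ∀ y, |β y - 𝔼 y', β y'| ≤ η := by
    intro y
    have : β y - 𝔼 y', β y' = 𝔼 y', (β y - β y') := by
      rw [expect_sub_distrib, Fintype.expect_const]
    rw [this]
    exact (abs_expect_le _ _).trans (expect_le univ_nonempty fun y' _ => hosc y y')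
  have hcard : (Fintype.card Y : ℝ) ≠ 0 := by positivity
  have : 𝔼 x, g (p x) * b x - (𝔼 y, g y) * 𝔼 x, b x = ∑ y, g y * (β y - 𝔼 y', β y') := by
    rw [hsum, hb]
    simp only [mul_sub, sum_sub_distrib, ← sum_mul, Fintype.expect_eq_sum_div_card]
    ring
  rw [this, sum_mul]
  refine (abs_sum_le_sum_abs _ _).trans (sum_le_sum fun y _ => ?_)
  rw [abs_mul]
  exact mul_le_mul_of_nonneg_left (hav y) (abs_nonneg _)

/-- The case b = 1, η = 0 of near independence: by transitivity, uniform measure pushes forward to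
uniform measure. -/
theorem expect_comp_eq_expect {Y : Type*} [Fintype Y] [Nonempty Y] [Nonempty X]
    [MulAction K Y] [MulAction.IsPretransitive K Y] (p : X → Y)
    (hp : ∀ (k : K) x, p (k • x) = k • p x) (g : Y → ℝ) :
    𝔼 x, g (p x) = 𝔼 y, g y := by
  have h := abs_expect_comp_mul_sub_le p hp (fun _ => 1) 0 (fun y y' => by
    obtain ⟨k, hk⟩ := MulAction.exists_smul_eq K y y'
    exact ⟨k, hk, by simp⟩) g
  simp only [mul_one, mul_zero, Fintype.expect_const] at h
  exact sub_eq_zero.1 (abs_nonpos_iff.1 h)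

end Expect

universe u

/-- Displacement in mean by a group element is controlled by the displacement by generators. -/
theorem exists_expect_abs_smul_sub_le {K : Type*} [Group K] {T : Set K} {k : K}
    (hk : k ∈ Subgroup.closure T) :
    ∃ C : ℝ, 0 ≤ C ∧ ∀ (X : Type u) [Fintype X] [MulAction K X] (b : X → ℝ) (η : ℝ), 0 ≤ η →
      (∀ t ∈ T, 𝔼 x, |b (t • x) - b x| ≤ η) → 𝔼 x, |b (k • x) - b x| ≤ C * η := by
  induction hk using Subgroup.closure_induction with
  | mem t ht => exact ⟨1, zero_le_one, fun X _ _ b η _ h => by simpa using h t ht⟩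
  | one => exact ⟨0, le_rfl, fun X _ _ b η _ h => by simp⟩
  | mul k l _ _ hk hl =>
    obtain ⟨C, hC, hk⟩ := hk
    obtain ⟨D, hD, hl⟩ := hl
    refine ⟨C + D, by positivity, fun X _ _ b η hη h => ?_⟩
    have e := expect_smul_eq_expect l fun x => |b (k • x) - b x|
    calc 𝔼 x, |b ((k * l) • x) - b x|
        ≤ 𝔼 x, (|b (k • l • x) - b (l • x)| + |b (l • x) - b x|) :=
          expect_le_expect fun x _ => by
            rw [mul_smul]
            exact abs_sub_le _ _ _
      _ ≤ C * η + D * η := by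
          rw [expect_add_distrib, e]
          exact add_le_add (hk X b η hη h) (hl X b η hη h)
      _ = (C + D) * η := by ring
  | inv k _ hk =>
    obtain ⟨C, hC, hk⟩ := hk
    refine ⟨C, hC, fun X _ _ b η hη h => ?_⟩
    rw [← expect_smul_eq_expect k]
    simpa [abs_sub_comm] using hk X b η hη h

/-- Finitely many pairs (y, y') need only finitely many connecting elements, so one C serves them
all. It is chosen before X and b, which lets the second factor of a product be chosen after the
first. -/
theorem exists_smul_eq_and_expect_abs_smul_sub_le {K : Type*} [Group K] {T : Set K}
    (hT : Subgroup.closure T = ⊤) (Y : Type*) [Finite Y] [MulAction K Y]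
    [MulAction.IsPretransitive K Y] :
    ∃ C : ℝ, 0 ≤ C ∧ ∀ (X : Type u) [Fintype X] [MulAction K X] (b : X → ℝ) (η : ℝ), 0 ≤ η →
      (∀ t ∈ T, 𝔼 x, |b (t • x) - b x| ≤ η) →
      ∀ y y' : Y, ∃ k : K, k • y = y' ∧ 𝔼 x, |b (k • x) - b x| ≤ C * η := by
  choose k hk using fun q : Y × Y => MulAction.exists_smul_eq K q.1 q.2
  choose C hC hCb using fun q : Y × Y =>
    exists_expect_abs_smul_sub_le.{u} (T := T) (k := k q) (hT ▸ Subgroup.mem_top _)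
  obtain ⟨D, hD⟩ := (Set.finite_range C).bddAbove
  refine ⟨max D 0, le_max_right _ _, fun X _ _ b η hη h y y' =>
    ⟨k (y, y'), hk (y, y'), (hCb (y, y') X b η hη h).trans ?_⟩⟩
  exact mul_le_mul_of_nonneg_right ((hD ⟨_, rfl⟩).trans (le_max_left _ _)) hη

/-- A normalised function that is almost invariant under generators is, together with its square,
nearly independent of a given function on a given finite transitive quotient. -/
theorem exists_forall_abs_expect_comp_mul_sub_le {K : Type*} [Group K] {T : Set K}
    (hT : Subgroup.closure T = ⊤) {Y : Type*} [Fintype Y] [Nonempty Y] [MulAction K Y]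
    [MulAction.IsPretransitive K Y] (g : Y → ℝ) {η : ℝ} (hη : 0 < η) :
    ∃ δ : ℝ, 0 < δ ∧ ∀ (X : Type u) [Fintype X] [Nonempty X] [MulAction K X] (p : X → Y),
      (∀ (k : K) x, p (k • x) = k • p x) → ∀ b : X → ℝ, 𝔼 x, b x ^ 2 = 1 →
      (∀ t ∈ T, 𝔼 x, (b (t • x) - b x) ^ 2 ≤ δ) →
      |𝔼 x, g (p x) * b x - (𝔼 y, g y) * 𝔼 x, b x| ≤ η ∧
      |𝔼 x, g (p x) * b x ^ 2 - 𝔼 y, g y| ≤ η := by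
  obtain ⟨C, hC, hCb⟩ := exists_smul_eq_and_expect_abs_smul_sub_le.{u} hT Y
  set A := ∑ y, |g y|
  have hA : 0 ≤ A := sum_nonneg fun _ _ => abs_nonneg _
  -- The 2 pays for passing from b to b²: |b(tx)² - b(x)²| factors, and the factor b(tx) + b(x) has
  -- L²-norm at most 2.
  set ε := η / (2 * (A * C + 1)) with hε
  have hAC : 0 ≤ A * C := by positivity
  have hε0 : 0 < ε := by positivity
  have hεη : A * (C * (2 * ε)) ≤ η := by
    have : (A * C + 1) * (2 * ε) = η := by
      rw [hε]
      field_simp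
    nlinarith
  refine ⟨ε ^ 2, by positivity, fun X _ _ _ p hp b hb hbT => ?_⟩
  have hsqrt : ∀ t ∈ T, √(𝔼 x, (b (t • x) - b x) ^ 2) ≤ ε := fun t ht =>
    (Real.sqrt_le_sqrt (hbT t ht)).trans (Real.sqrt_sq hε0.le).le
  constructor
  · refine (abs_expect_comp_mul_sub_le p hp b _ (hCb X b (2 * ε) (by positivity) fun t ht => ?_)
      g).trans hεη
    have := (expect_abs_le_sqrt fun x => b (t • x) - b x).trans (hsqrt t ht)
    linarith
  · have := abs_expect_comp_mul_sub_le p hp (fun x => b x ^ 2) _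
      (hCb X (fun x => b x ^ 2) (2 * ε) (by positivity) fun t ht => ?_) g
    · rw [hb, mul_one] at this
      exact this.trans hεη
    have h4 : 𝔼 x, (b (t • x) + b x) ^ 2 ≤ 2 ^ 2 := by
      have e := expect_smul_eq_expect t fun x => b x ^ 2
      calc 𝔼 x, (b (t • x) + b x) ^ 2 ≤ 𝔼 x, (2 * b (t • x) ^ 2 + 2 * b x ^ 2) :=
            expect_le_expect fun x _ => by nlinarith [sq_nonneg (b (t • x) - b x)]
        _ = 2 ^ 2 := by
            rw [expect_add_distrib, ← mul_expect, ← mul_expect, e, hb]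
            norm_num
    have h2 : √(𝔼 x, (b (t • x) + b x) ^ 2) ≤ 2 :=
      (Real.sqrt_le_sqrt h4).trans (Real.sqrt_sq zero_le_two).le
    calc 𝔼 x, |b (t • x) ^ 2 - b x ^ 2|
        = 𝔼 x, |(b (t • x) + b x) * (b (t • x) - b x)| :=
          expect_congr rfl fun x _ => by ring_nf
      _ ≤ √(𝔼 x, (b (t • x) + b x) ^ 2) * √(𝔼 x, (b (t • x) - b x) ^ 2) :=
          expect_abs_mul_le_sqrt _ _
      _ ≤ 2 * ε := mul_le_mul h2 (hsqrt t ht) (Real.sqrt_nonneg _) zero_le_two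

theorem quotientMapOfLE_smul {K : Type*} [Group K] {L N : Subgroup K} (h : L ≤ N) (k : K)
    (x : K ⧸ L) : Subgroup.quotientMapOfLE h (k • x) = k • Subgroup.quotientMapOfLE h x := by
  induction x using QuotientGroup.induction_on
  rfl

/-! ### Almost invariant functions on a chain, and amplification by products -/

section AlmostInvariant

variable {K : Type*} [Group K] {N : ℕ → Subgroup K} [∀ n, Fintype (K ⧸ N n)]

/-- There are nonnegative normalised functions on the finite quotients `K ⧸ N n` that are
arbitrarily little moved by `T` and whose mean is at most `r`, up to an arbitrarily small error. -/
def HasAlmostInvariantOfMeanLE (N : ℕ → Subgroup K) [∀ n, Fintype (K ⧸ N n)] (T : Finset K)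
    (r : ℝ) : Prop :=
  ∀ δ > 0, ∃ (n : ℕ) (ψ : K ⧸ N n → ℝ), (∀ x, 0 ≤ ψ x) ∧ 𝔼 x, ψ x ^ 2 = 1 ∧
    (∀ t ∈ T, 𝔼 x, (ψ (t • x) - ψ x) ^ 2 ≤ δ) ∧ 𝔼 x, ψ x ≤ r + δ

/-- Fix a on one quotient, then take b so invariant that it is nearly independent of everything read
off that quotient. On a common quotient, ab has mean about E a · E b and second moment about 1, and
its displacement is controlled by those of a and b. -/
theorem HasAlmostInvariantOfMeanLE.mul {T : Finset K} (hN : Antitone N)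
    (hT : Subgroup.closure (T : Set K) = ⊤) {r s : ℝ} (hr : 0 ≤ r)
    (h₁ : HasAlmostInvariantOfMeanLE N T r) (h₂ : HasAlmostInvariantOfMeanLE N T s) :
    HasAlmostInvariantOfMeanLE N T (r * s) := by
  intro δ hδ
  -- The two fractions are the final bounds for mean and displacement after division by the L²-norm;
  -- by continuity at 0 a small ε is enough.
  obtain ⟨ε, hε, hε1, hεmean, hεdisp⟩ : ∃ ε : ℝ, 0 < ε ∧ ε < 1 ∧
      ((r + ε) * (s + ε) + ε) / (1 - ε) < r * s + δ ∧ 6 * ε / (1 - ε) < δ := by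
    have c1 : ContinuousAt (fun ε : ℝ => ((r + ε) * (s + ε) + ε) / (1 - ε)) 0 :=
      ContinuousAt.div (by fun_prop) (by fun_prop) (by norm_num)
    have c2 : ContinuousAt (fun ε : ℝ => 6 * ε / (1 - ε)) 0 :=
      ContinuousAt.div (by fun_prop) (by fun_prop) (by norm_num)
    have e1 := c1.eventually_lt (g := fun _ => r * s + δ) continuousAt_const (by simpa using hδ)
    have e2 := c2.eventually_lt (g := fun _ => δ) continuousAt_const (by simpa using hδ)
    have e3 : ∀ᶠ ε : ℝ in nhdsWithin 0 (Set.Ioi 0), ε < 1 :=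
      (eventually_lt_nhds zero_lt_one).filter_mono nhdsWithin_le_nhds
    obtain ⟨ε, h0, h1, h2, h3⟩ := ((e1.filter_mono nhdsWithin_le_nhds).and
      ((e2.filter_mono nhdsWithin_le_nhds).and (e3.and self_mem_nhdsWithin))).exists
    exact ⟨ε, h3, h2, h0, h1⟩
  have hε' : 0 < 1 - ε := sub_pos.2 hε1
  obtain ⟨n, a, ha0, ha2, haT, ham⟩ := h₁ (ε / (T.card + 1)) (by positivity)
  have ham : 𝔼 x, a x ≤ r + ε := ham.trans (by
    gcongr
    exact div_le_self hε.le (by linarith [T.card.cast_nonneg (α := ℝ)]))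
  set e : K ⧸ N n → ℝ := fun y => ∑ t ∈ T, (a (t • y) - a y) ^ 2 with he
  have hee : 𝔼 y, e y ≤ ε := by
    rw [he, expect_sum_comm]
    calc ∑ t ∈ T, 𝔼 y, (a (t • y) - a y) ^ 2 ≤ ∑ t ∈ T, ε / (T.card + 1) := sum_le_sum haT
      _ = T.card / (T.card + 1) * ε := by
          rw [sum_const, nsmul_eq_mul]
          ring
      _ ≤ 1 * ε := by
          gcongr
          exact (div_le_one (by positivity)).2 (by linarith)
      _ = ε := one_mul ε
  obtain ⟨A, hA⟩ := (Set.finite_range fun y => a y ^ 2).bddAbove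
  have hA : ∀ y, a y ^ 2 ≤ A := fun y => hA ⟨y, rfl⟩
  have hA0 : 0 ≤ A := (sq_nonneg _).trans (hA (1 : K))
  -- Near independence is needed of b from a (mean of the product), and of b² from a² (its norm) and
  -- from the displacement e (its invariance).
  obtain ⟨δ₁, hδ₁, E₁⟩ := exists_forall_abs_expect_comp_mul_sub_le hT a hε
  obtain ⟨δ₂, hδ₂, E₂⟩ := exists_forall_abs_expect_comp_mul_sub_le hT (fun y => a y ^ 2) hε
  obtain ⟨δ₃, hδ₃, E₃⟩ := exists_forall_abs_expect_comp_mul_sub_le hT e hε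
  set κ := min (min δ₁ δ₂) (min δ₃ (ε / (A + 1))) with hκ
  have hκ0 : 0 < κ := by positivity
  have hκ1 : κ ≤ δ₁ := (min_le_left _ _).trans (min_le_left _ _)
  have hκ2 : κ ≤ δ₂ := (min_le_left _ _).trans (min_le_right _ _)
  have hκ3 : κ ≤ δ₃ := (min_le_right _ _).trans (min_le_left _ _)
  have hκ4 : κ ≤ ε / (A + 1) := (min_le_right _ _).trans (min_le_right _ _)
  have hκA : (A + 1) * κ ≤ ε := by
    rw [le_div_iff₀ (by positivity)] at hκ4
    linarith
  obtain ⟨m, b', hb0, hb2, hbT, hbm⟩ := h₂ κ hκ0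
  set p : K ⧸ N (max n m) → K ⧸ N n := Subgroup.quotientMapOfLE (hN (le_max_left n m))
  set q : K ⧸ N (max n m) → K ⧸ N m := Subgroup.quotientMapOfLE (hN (le_max_right n m))
  have hp : ∀ (k : K) x, p (k • x) = k • p x := fun k x => quotientMapOfLE_smul _ k x
  have hq : ∀ (k : K) x, q (k • x) = k • q x := fun k x => quotientMapOfLE_smul _ k x
  set b : K ⧸ N (max n m) → ℝ := fun x => b' (q x) with hb
  replace hb0 : ∀ x, 0 ≤ b x := fun x => hb0 _
  replace hb2 : 𝔼 x, b x ^ 2 = 1 := by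
    rw [← hb2]
    exact expect_comp_eq_expect q hq fun y => b' y ^ 2
  replace hbT : ∀ t ∈ T, 𝔼 x, (b (t • x) - b x) ^ 2 ≤ κ := fun t ht => by
    refine le_of_eq_of_le ?_ (hbT t ht)
    simp only [hb, hq]
    exact expect_comp_eq_expect q hq fun y => (b' (t • y) - b' y) ^ 2
  replace hbm : 𝔼 x, b x ≤ s + ε := by
    have h1 : 𝔼 x, b x = 𝔼 y, b' y := expect_comp_eq_expect q hq b'
    have : κ ≤ (A + 1) * κ := le_mul_of_one_le_left hκ0.le (by linarith)
    linarith
  have hb1 : 0 ≤ 𝔼 x, b x := expect_nonneg fun x _ => hb0 x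
  have F₁ := (E₁ _ p hp b hb2 fun t ht => (hbT t ht).trans hκ1).1
  have F₂ := (E₂ _ p hp b hb2 fun t ht => (hbT t ht).trans hκ2).2
  have F₃ := (E₃ _ p hp b hb2 fun t ht => (hbT t ht).trans hκ3).2
  rw [ha2, abs_le] at F₂
  rw [abs_le] at F₁ F₃
  set Q : K ⧸ N (max n m) → ℝ := fun x => a (p x) * b x with hQ
  set v := 𝔼 x, Q x ^ 2 with hv
  have hv' : v = 𝔼 x, a (p x) ^ 2 * b x ^ 2 := by simp only [hv, hQ, mul_pow]
  have hv1 : 1 - ε ≤ v := by linarith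
  have hv0 : 0 < v := hε'.trans_le hv1
  have hsv : 0 < √v := Real.sqrt_pos.2 hv0
  have hsv1 : 1 - ε ≤ √v := Real.le_sqrt_of_sq_le (by nlinarith)
  have hdiv : ∀ x y : ℝ, (x / √v - y / √v) ^ 2 = (x - y) ^ 2 / v := fun x y => by
    rw [← sub_div, div_pow, Real.sq_sqrt hv0.le]
  refine ⟨max n m, fun x => Q x / √v, fun x => ?_, ?_, fun t ht => ?_, ?_⟩
  · exact div_nonneg (mul_nonneg (ha0 _) (hb0 _)) hsv.le
  · simp only [div_pow, Real.sq_sqrt hv0.le]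
    rw [← expect_div, ← hv, div_self hv0.ne']
  · simp only [hdiv]
    rw [← expect_div]
    have hpt : ∀ x, (Q (t • x) - Q x) ^ 2 ≤
        2 * A * (b (t • x) - b x) ^ 2 + 2 * (e (p x) * b x ^ 2) := by
      intro x
      have h1 : (a (t • p x) - a (p x)) ^ 2 ≤ e (p x) :=
        single_le_sum (f := fun t => (a (t • p x) - a (p x)) ^ 2) (fun _ _ => sq_nonneg _) ht
      have h2 := hA (t • p x)
      have h3 : Q (t • x) - Q x
          = a (t • p x) * (b (t • x) - b x) + (a (t • p x) - a (p x)) * b x := by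
        simp only [hQ, hp]
        ring
      rw [h3]
      have h4 := mul_le_mul_of_nonneg_right h1 (sq_nonneg (b x))
      have h5 := mul_le_mul_of_nonneg_right h2 (sq_nonneg (b (t • x) - b x))
      refine add_sq_le.trans ?_
      rw [mul_pow, mul_pow]
      linarith
    -- The first term costs 2Aκ ≤ 2ε; the second at most 4ε, since E[e b²] ≤ E e + ε ≤ 2ε.
    have hnum : 𝔼 x, (Q (t • x) - Q x) ^ 2 ≤ 6 * ε := by
      refine (expect_le_expect fun x _ => hpt x).trans ?_
      rw [expect_add_distrib, ← mul_expect, ← mul_expect]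
      have := mul_le_mul_of_nonneg_left (hbT t ht) hA0
      linarith
    calc _ ≤ 6 * ε / (1 - ε) := div_le_div₀ (by positivity) hnum hε' hv1
      _ ≤ δ := hεdisp.le
  · rw [← expect_div]
    have hnum : 𝔼 x, Q x ≤ (r + ε) * (s + ε) + ε := by
      have := mul_le_mul ham hbm hb1 (by positivity)
      linarith
    have h0 : 0 ≤ (r + ε) * (s + ε) + ε := by
      have : 0 ≤ s + ε := hb1.trans hbm
      positivity
    exact (div_le_div₀ h0 hnum hε' hsv1).trans hεmean.le

theorem HasAlmostInvariantOfMeanLE.pow {T : Finset K} (hN : Antitone N)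
    (hT : Subgroup.closure (T : Set K) = ⊤) {r : ℝ} (hr : 0 ≤ r)
    (h : HasAlmostInvariantOfMeanLE N T r) (k : ℕ) :
    HasAlmostInvariantOfMeanLE N T (r ^ (k + 1)) := by
  induction k with
  | zero => simpa using h
  | succ k ih =>
    rw [pow_succ]
    exact ih.mul hN hT (by positivity) h

/-- Norm bounds for the positive part of a mean-zero function whose negative part is no larger in
`L²`. -/
theorem expect_posPart_sq_le_expect_sq {X : Type*} [Fintype X] {f : X → ℝ} (hf : 𝔼 x, f x = 0)
    (hle : 𝔼 x, min (f x) 0 ^ 2 ≤ 𝔼 x, max (f x) 0 ^ 2) :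
    𝔼 x, f x ^ 2 ≤ 2 * 𝔼 x, max (f x) 0 ^ 2 ∧
      2 * (𝔼 x, max (f x) 0) ^ 2 ≤ 𝔼 x, max (f x) 0 ^ 2 := by
  have h1 : ∀ x, f x ^ 2 = max (f x) 0 ^ 2 + min (f x) 0 ^ 2 := fun x => by
    rcases le_total (f x) 0 with h | h <;> simp [h]
  have h2 : ∀ x, |f x| = 2 * max (f x) 0 - f x := fun x => by
    rcases le_total (f x) 0 with h | h <;> simp [h, abs_of_nonpos, abs_of_nonneg]; ring
  have h3 : 𝔼 x, f x ^ 2 ≤ 2 * 𝔼 x, max (f x) 0 ^ 2 := by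
    simp only [h1, expect_add_distrib]
    linarith
  refine ⟨h3, ?_⟩
  rcases isEmpty_or_nonempty X with _ | _
  · simp
  -- Cauchy–Schwarz against 1; mean zero gives E|f| = 2 E f⁺, so 4 (E f⁺)² ≤ E f² ≤ 2 E (f⁺)².
  have h4 := expect_mul_sq_le_sq_mul_sq univ (fun x => |f x|) fun _ => 1
  have h5 : 𝔼 x, |f x| = 2 * 𝔼 x, max (f x) 0 := by
    simp only [h2, expect_sub_distrib, ← mul_expect, hf, sub_zero]
  simp only [mul_one, h5, sq_abs, one_pow, Fintype.expect_const] at h4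
  linarith

/-- Without a uniform spectral gap there are almost invariant functions that are far from being
constant. -/
theorem hasAlmostInvariantOfMeanLE_of_forall_rhoPlus {T : Finset K}
    (h : ∀ ε > 0, ∃ n, ((1 - ε : ℝ) : EReal) < rhoPlus (N n) T) :
    HasAlmostInvariantOfMeanLE N T √(1 / 2) := by
  intro δ hδ
  -- Makes 2|T|(1 - θ) ≤ δ/2; the remaining factor 2 is lost because f⁺ may carry only half of the
  -- L²-mass of f.
  set ε := δ / (4 * (T.card + 1)) with hε
  obtain ⟨n, hn⟩ := h ε (by positivity)
  obtain ⟨_, ⟨θ, ⟨f, hf0, hfs, hfM⟩, rfl⟩, hθ⟩ := lt_sSup_iff.1 hn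
  replace hθ : 1 - ε < θ := by exact_mod_cast hθ
  rw [finsum_eq_sum_of_fintype] at hfs
  have hdisp : ∀ t ∈ T, 𝔼 x, (f (t • x) - f x) ^ 2 ≤ δ / 2 * 𝔼 x, f x ^ 2 := by
    intro t ht
    have h1 : ∑ t ∈ T, ∑ x, f (t • x) * f x = T.card * (θ * ∑ x, f x ^ 2) := by
      have hc : (T.card : ℝ) ≠ 0 := by
        exact_mod_cast (card_pos.2 ⟨t, ht⟩).ne'
      have := sum_markovOp_mul T f f
      rw [hfM, eq_div_iff hc] at this
      rw [← this]
      simp only [Pi.smul_apply, smul_eq_mul, mul_sum, sum_mul]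
      exact sum_congr rfl fun x _ => by ring
    have h2 : ∑ t ∈ T, ∑ x, (f (t • x) - f x) ^ 2
        = 2 * T.card * ((1 - θ) * ∑ x, f x ^ 2) := by
      have : ∀ t ∈ T, ∑ x, (f (t • x) - f x) ^ 2
          = 2 * ∑ x, f x ^ 2 - 2 * ∑ x, f (t • x) * f x := fun t _ => by
        have e := sum_smul_eq_sum t fun x => f x ^ 2
        rw [two_mul (∑ x, f x ^ 2)]
        nth_rewrite 1 [← e]
        rw [mul_sum, ← sum_add_distrib, ← sum_sub_distrib]
        exact sum_congr rfl fun x _ => by ring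
      rw [sum_congr rfl this, sum_sub_distrib, ← mul_sum, ← mul_sum, h1, sum_const, nsmul_eq_mul]
      ring
    have h3 : ∑ x, (f (t • x) - f x) ^ 2 ≤ 2 * T.card * ((1 - θ) * ∑ x, f x ^ 2) := by
      rw [← h2]
      exact single_le_sum (f := fun t => ∑ x, (f (t • x) - f x) ^ 2)
        (fun _ _ => sum_nonneg fun _ _ => sq_nonneg _) ht
    have hs : 0 ≤ ∑ x, f x ^ 2 := sum_nonneg fun _ _ => sq_nonneg _
    have h4 : 2 * T.card * ((1 - θ) * ∑ x, f x ^ 2) ≤ δ / 2 * ∑ x, f x ^ 2 := by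
      have h5 : 2 * T.card * (1 - θ) ≤ δ / 2 := by
        have : 2 * (T.card + 1) * ε = δ / 2 := by
          rw [hε]
          field_simp
          norm_num
        have hc : (0 : ℝ) ≤ T.card := Nat.cast_nonneg _
        have hε0 : 0 < ε := by positivity
        nlinarith
      have := mul_le_mul_of_nonneg_right h5 hs
      linarith
    simp only [Fintype.expect_eq_sum_div_card, ← mul_div_assoc]
    gcongr
    exact h3.trans h4
  have hmean : 𝔼 x, f x = 0 := by rw [Fintype.expect_eq_sum_div_card, hfs, zero_div]
  clear hfM hfs hn hθ
  wlog hle : 𝔼 x, min (f x) 0 ^ 2 ≤ 𝔼 x, max (f x) 0 ^ 2 generalizing f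
  · refine this (-f) (neg_ne_zero.2 hf0) (fun t ht => ?_) ?_ ?_
    · simpa [neg_add_eq_sub, sub_sq_comm] using hdisp t ht
    · simp [expect_neg_distrib, hmean]
    · have e1 : ∀ x, min (-f x) 0 ^ 2 = max (f x) 0 ^ 2 := fun x => by
        rcases le_total (f x) 0 with h | h <;> simp [h]
      have e2 : ∀ x, max (-f x) 0 ^ 2 = min (f x) 0 ^ 2 := fun x => by
        rcases le_total (f x) 0 with h | h <;> simp [h]
      simp only [Pi.neg_apply, e1, e2]
      exact (not_le.1 hle).le
  obtain ⟨h2, hm⟩ := expect_posPart_sq_le_expect_sq hmean hle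
  set v := 𝔼 x, max (f x) 0 ^ 2
  have hv : 0 < v := by
    obtain ⟨x, hx⟩ := Function.ne_iff.1 hf0
    replace hx : f x ≠ 0 := hx
    have : 0 < 𝔼 x, f x ^ 2 :=
      expect_pos' (fun _ _ => sq_nonneg _) ⟨x, mem_univ x, by positivity⟩
    linarith
  refine ⟨n, fun x => max (f x) 0 / √v, fun x => by positivity, ?_, fun t ht => ?_, ?_⟩
  · simp only [div_pow, Real.sq_sqrt hv.le]
    rw [← expect_div, div_self hv.ne']
  · simp only [← sub_div, div_pow, Real.sq_sqrt hv.le]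
    rw [← expect_div, div_le_iff₀ hv]
    calc 𝔼 x, (max (f (t • x)) 0 - max (f x) 0) ^ 2 ≤ 𝔼 x, (f (t • x) - f x) ^ 2 :=
          expect_le_expect fun x _ => sq_le_sq.2 (abs_max_sub_max_le_abs _ _ _)
      _ ≤ δ / 2 * 𝔼 x, f x ^ 2 := hdisp t ht
      _ ≤ δ / 2 * (2 * v) := by gcongr
      _ = δ * v := by ring
  · rw [← expect_div]
    have : (𝔼 x, max (f x) 0) / √v ≤ √(1 / 2) := by
      rw [div_le_iff₀ (Real.sqrt_pos.2 hv), ← Real.sqrt_mul (by norm_num)]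
      exact Real.le_sqrt_of_sq_le (by linarith)
    linarith

/-- If nonnegative almost invariant functions on the quotients of a chain have `L¹`-norm bounded
below by a multiple of their `L²`-norm, then the Schreier graphs of the chain have a uniform
spectral gap. -/
theorem exists_forall_rhoPlus_le {T : Finset K} (hN : Antitone N)
    (hTgen : Subgroup.closure (T : Set K) = ⊤) {c δ : ℝ} (hc : 0 < c) (hδ : 0 < δ)
    (h : ∀ n (ψ : K ⧸ N n → ℝ), (∀ x, 0 ≤ ψ x) →
      (∀ t ∈ T, ∑ x, (ψ (t • x) - ψ x) ^ 2 ≤ δ * ∑ x, ψ x ^ 2) →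
      c * Fintype.card (K ⧸ N n) * ∑ x, ψ x ^ 2 ≤ (∑ x, ψ x) ^ 2) :
    ∃ ε : ℝ, 0 < ε ∧ ∀ n, rhoPlus (N n) T ≤ ((1 - ε : ℝ) : EReal) := by
  by_contra! hcon
  have hP := (hasAlmostInvariantOfMeanLE_of_forall_rhoPlus hcon).pow hN hTgen
    (Real.sqrt_nonneg _)
  have hsc := Real.sqrt_pos.2 hc
  have hlt : √(1 / 2 : ℝ) < 1 := by
    rw [Real.sqrt_lt' one_pos]
    norm_num
  obtain ⟨k, hk⟩ := exists_pow_lt_of_lt_one (half_pos hsc) hlt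
  have hk' : √(1 / 2 : ℝ) ^ (k + 1) < √c / 2 :=
    (pow_le_pow_of_le_one (Real.sqrt_nonneg _) hlt.le k.le_succ).trans_lt hk
  -- The power and the error each stay within √c/2, so the mean falls below √c, while the hypothesis
  -- forces it to be at least √c.
  obtain ⟨n, ψ, hψ0, hψ2, hψT, hψm⟩ := hP k (min δ (√c / 2)) (by positivity)
  have hcard : (0 : ℝ) < Fintype.card (K ⧸ N n) := by
    exact_mod_cast Fintype.card_pos
  rw [Fintype.expect_eq_sum_div_card, div_eq_one_iff_eq hcard.ne'] at hψ2
  have := h n ψ hψ0 fun t ht => by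
    have := (hψT t ht).trans (min_le_left _ _)
    rwa [Fintype.expect_eq_sum_div_card, div_le_iff₀ hcard, ← hψ2] at this
  have hm : 𝔼 x, ψ x < √c := by linarith [min_le_right δ (√c / 2)]
  rw [Fintype.expect_eq_sum_div_card, div_lt_iff₀ hcard] at hm
  have hs : 0 ≤ ∑ x, ψ x := sum_nonneg fun x _ => hψ0 x
  have := pow_lt_pow_left₀ hm hs two_ne_zero
  rw [mul_pow, Real.sq_sqrt hc.le] at this
  rw [hψ2] at *
  nlinarith

end AlmostInvariant

/-! ### Test functions on right cosets and their edge labels -/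

section RightCosets

variable {G : Type*} [Group G] {H : Subgroup G}

theorem rightCosetMul_mul (a b : G) (x : RightCosets H) :
    rightCosetMul H (a * b) x = rightCosetMul H b (rightCosetMul H a x) := by
  induction x using Quotient.inductionOn
  simp [rightCosetMul, mul_assoc]

theorem rightCosetMul_one (x : RightCosets H) : rightCosetMul H 1 x = x := by
  induction x using Quotient.inductionOn
  simp [rightCosetMul]

theorem rightCosetMul_inv_rightCosetMul (a : G) (x : RightCosets H) :
    rightCosetMul H a⁻¹ (rightCosetMul H a x) = x := by
  rw [← rightCosetMul_mul, mul_inv_cancel, rightCosetMul_one]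

theorem rightCosetMul_injective (a : G) : Function.Injective (rightCosetMul H a) :=
  Function.LeftInverse.injective (g := rightCosetMul H a⁻¹) (rightCosetMul_inv_rightCosetMul a)

/-- The Schreier generator attached to the edge from c to cs, for the transversal `Quotient.out`. -/
theorem out_mul_mul_out_inv_mem (c : RightCosets H) (s : G) :
    c.out * s * (rightCosetMul H s c).out⁻¹ ∈ H := by
  rw [← QuotientGroup.rightRel_apply, ← Quotient.eq, Quotient.out_eq]
  conv_lhs => rw [← Quotient.out_eq c]
  rfl

/-- The relative spectral radius is approximated by nonnegative finitely supported functions. -/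
theorem exists_finite_support_of_lt_relSpectralRadius {S : Finset G} {θ : ℝ}
    (hθ : θ < relSpectralRadius H S) :
    ∃ (A : Finset (RightCosets H)) (f : RightCosets H → ℝ), (∀ c, 0 ≤ f c) ∧
      (∀ c ∉ A, f c = 0) ∧
      θ * ∑ c ∈ A, f c ^ 2 < (∑ s ∈ S, ∑ c ∈ A, f (rightCosetMul H s c) * f c) / S.card := by
  classical
  -- Truncation lowers ∑ f², which helps only for θ ≥ 0. For θ < 0 a point mass suffices, its
  -- Rayleigh quotient being nonnegative.
  rcases lt_or_ge θ 0 with hneg | hpos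
  · let o : RightCosets H := Quotient.mk _ 1
    have h0 : ∀ c, 0 ≤ (Pi.single o 1 : RightCosets H → ℝ) c := fun c => by
      by_cases h : c = o <;> simp [h]
    refine ⟨{o}, Pi.single o 1, h0, fun c hc => ?_, ?_⟩
    · rw [mem_singleton] at hc
      simp [hc]
    · refine lt_of_lt_of_le (b := 0) (by simpa using hneg) ?_
      exact div_nonneg (sum_nonneg fun s _ => sum_nonneg fun c _ => mul_nonneg (h0 _) (h0 _))
        (Nat.cast_nonneg _)
  obtain ⟨r, ⟨f, hf0, hf, rfl⟩, hr⟩ := exists_lt_of_lt_csSup (by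
    let o : RightCosets H := Quotient.mk _ 1
    refine ⟨_, Pi.single o 1, fun h => ?_, ?_, rfl⟩
    · simpa using congrFun h o
    · refine memℓp_gen (summable_of_ne_finset_zero (s := {o}) fun c hc => ?_)
      rw [mem_singleton] at hc
      simp [hc]) hθ
  have hsum : Summable fun c => f c ^ 2 := by
    have := hf.summable (by norm_num)
    simpa using this
  have hsum' : ∀ s, Summable fun c => f (rightCosetMul H s c) ^ 2 := fun s =>
    hsum.comp_injective (rightCosetMul_injective s)
  have hD : 0 < ∑' c, f c ^ 2 := by
    obtain ⟨c, hc⟩ := Function.ne_iff.1 hf0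
    replace hc : f c ≠ 0 := hc
    exact hsum.tsum_pos (fun _ => sq_nonneg _) c (by positivity)
  simp only [← pow_two (f _)] at hr
  rw [lt_div_iff₀ hD] at hr
  set w : RightCosets H → ℝ := fun c => (∑ s ∈ S, |f (rightCosetMul H s c)| * |f c|) / S.card
  have hw : Summable w := by
    refine Summable.div_const (summable_sum fun s _ => ?_) _
    refine ((hsum' s).add hsum).of_nonneg_of_le (fun _ => by positivity) fun c => ?_
    rw [← sq_abs, ← sq_abs (f c)]
    nlinarith [sq_nonneg (|f (rightCosetMul H s c)| - |f c|),
      sq_nonneg (|f (rightCosetMul H s c)|), sq_nonneg |f c|]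
  have hle : ∀ c, |markovOp S (rightCosetMul H) f c * f c| ≤ w c := fun c => by
    simp only [markovOp, w]
    rw [div_mul_eq_mul_div, abs_div, Nat.abs_cast, sum_mul]
    gcongr
    exact (abs_sum_le_sum_abs _ _).trans (sum_le_sum fun s _ => (abs_mul _ _).le)
  have hlt : θ * ∑' c, f c ^ 2 < ∑' c, w c :=
    hr.trans_le (Summable.tsum_le_tsum (fun c => (le_abs_self _).trans (hle c))
      (hw.of_norm_bounded hle) hw)
  obtain ⟨B, hB⟩ := (hw.hasSum.eventually (lt_mem_nhds hlt)).exists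
  -- Adding the S-neighbours of B keeps every edge that starts in B, so truncation to A preserves
  -- the terms of w on B.
  set A := B ∪ S.biUnion fun s => B.image (rightCosetMul H s) with hA
  have hBA : B ⊆ A := subset_union_left
  have hSA : ∀ s ∈ S, ∀ c ∈ B, rightCosetMul H s c ∈ A := fun s hs c hc =>
    mem_union_right _ (mem_biUnion.2 ⟨s, hs, mem_image_of_mem _ hc⟩)
  set g : RightCosets H → ℝ := fun c => if c ∈ A then |f c| else 0 with hg
  have hg0 : ∀ c, 0 ≤ g c := fun c => by
    simp only [hg]
    split_ifs <;> positivity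
  refine ⟨A, g, hg0, fun c hc => by simp [hg, hc], ?_⟩
  calc θ * ∑ c ∈ A, g c ^ 2 ≤ θ * ∑' c, f c ^ 2 := by
        refine mul_le_mul_of_nonneg_left ?_ hpos
        refine le_of_eq_of_le (sum_congr rfl fun c hc => ?_)
          (hsum.sum_le_tsum A fun _ _ => sq_nonneg _)
        simp [hg, hc]
    _ < ∑ c ∈ B, w c := hB
    _ = (∑ s ∈ S, ∑ c ∈ B, g (rightCosetMul H s c) * g c) / S.card := by
        rw [sum_comm, sum_div]
        refine sum_congr rfl fun c hc => ?_
        simp only [w]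
        congr 1
        refine sum_congr rfl fun s hs => ?_
        simp [hg, hSA s hs c hc, hBA hc]
    _ ≤ (∑ s ∈ S, ∑ c ∈ A, g (rightCosetMul H s c) * g c) / S.card := by
        gcongr with s hs

/-- The elements of `H` that are read along the edges inside a finite set `A` of vertices of the
Schreier graph of `H \ G`. -/
noncomputable def edgeLabels [DecidableEq G] (S : Finset G) (A : Finset (RightCosets H)) :
    Finset G :=
  open scoped Classical in
  ((A ×ˢ S).filter fun q => rightCosetMul H q.2 q.1 ∈ A).image fun q =>
    q.1.out * q.2 * (rightCosetMul H q.2 q.1).out⁻¹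

variable {S : Finset G} {A : Finset (RightCosets H)}

theorem sum_comp_rightCosetMul_le (s : G) {h : RightCosets H → ℝ} (h0 : ∀ c, 0 ≤ h c)
    (hA : ∀ c ∉ A, h c = 0) : ∑ c ∈ A, h (rightCosetMul H s c) ≤ ∑ c ∈ A, h c := by
  classical
  rw [← sum_image (f := h) fun _ _ _ _ e => rightCosetMul_injective s e]
  calc ∑ c ∈ A.image (rightCosetMul H s), h c ≤ ∑ c ∈ A.image (rightCosetMul H s) ∪ A, h c :=
        sum_le_sum_of_subset_of_nonneg subset_union_left fun _ _ _ => h0 _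
    _ = ∑ c ∈ A, h c := (sum_subset subset_union_right fun c _ hc => hA c hc).symm

variable {Y : Type*} [Fintype Y] [MulAction G Y]

/-- If the Rayleigh quotients of mean-zero functions are at most `θ`, then a function of larger
Rayleigh quotient has a large mean. -/
theorem sum_markovOp_mul_self_le_add [Nonempty Y] {θ : ℝ}
    (hY : ∀ f : Y → ℝ, ∑ y, f y = 0 →
      ∑ y, markovOp S (fun (s : G) (y : Y) => s • y) f y * f y ≤ θ * ∑ y, f y * f y)
    (f : Y → ℝ) :
    ∑ y, markovOp S (fun (s : G) (y : Y) => s • y) f y * f y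
      ≤ θ * ∑ y, f y ^ 2 + (1 + |θ|) * ((∑ y, f y) ^ 2 / Fintype.card Y) := by
  set M := markovOp S (fun (s : G) (y : Y) => s • y) with hM
  set q : ℝ := (S.card : ℝ) / S.card
  have hq : q ≤ 1 := div_self_le_one _
  have hcard : (0 : ℝ) < Fintype.card Y := by exact_mod_cast Fintype.card_pos
  set m := (∑ y, f y) / Fintype.card Y with hm
  have hm' : ∑ y, f y = m * Fintype.card Y := by
    rw [hm]
    field_simp
  set f₀ : Y → ℝ := fun y => f y - m
  have hf₀ : ∑ y, f₀ y = 0 := by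
    simp only [f₀, sum_sub_distrib, hm', sum_const, card_univ, nsmul_eq_mul]
    ring
  have hMf₀ : ∑ y, M f₀ y = 0 := by rw [hM, sum_markovOp, hf₀, mul_zero]
  have hMf : ∀ y, M f y = M f₀ y + q * m := fun y => by
    simp only [hM, markovOp, f₀, sum_sub_distrib, sum_const, nsmul_eq_mul, q]
    ring
  have e1 : ∑ y, M f y * f y = ∑ y, M f₀ y * f₀ y + q * (m ^ 2 * Fintype.card Y) := by
    have : ∀ y, M f y * f y = M f₀ y * f₀ y + m * M f₀ y + q * m * f₀ y + q * m ^ 2 := fun y => by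
      rw [hMf, show f y = f₀ y + m by simp [f₀]]
      ring
    simp only [this, sum_add_distrib, ← mul_sum, hMf₀, hf₀, sum_const, card_univ, nsmul_eq_mul]
    ring
  have e2 : ∑ y, f₀ y * f₀ y = ∑ y, f y ^ 2 - m ^ 2 * Fintype.card Y := by
    have : ∀ y, f₀ y * f₀ y = f y ^ 2 - 2 * m * f y + m ^ 2 := fun y => by
      simp only [f₀]
      ring
    simp only [this, sum_add_distrib, sum_sub_distrib, ← mul_sum, hm', sum_const, card_univ,
      nsmul_eq_mul]
    ring
  have e3 : (∑ y, f y) ^ 2 / Fintype.card Y = m ^ 2 * Fintype.card Y := by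
    rw [hm']
    field_simp
  have h0 : 0 ≤ m ^ 2 * Fintype.card Y := by positivity
  have h1 := hY f₀ hf₀
  rw [e2] at h1
  rw [e1, e3]
  -- The constant part of f contributes (q - θ) m² |Y|, and q - θ ≤ 1 + |θ| whatever the sign of θ.
  have h2 := mul_le_mul_of_nonneg_right hq h0
  have h3 := mul_le_mul_of_nonneg_right (neg_abs_le θ) h0
  linarith

/-! ### Transfer of the test function to finite quotients -/

section EdgeLabels

variable [DecidableEq G]

theorem mem_edgeLabels {t : G} : t ∈ edgeLabels S A ↔ ∃ c ∈ A, ∃ s ∈ S,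
    rightCosetMul H s c ∈ A ∧ c.out * s * (rightCosetMul H s c).out⁻¹ = t := by
  simp only [edgeLabels, mem_image, mem_filter, mem_product, Prod.exists]
  constructor
  · rintro ⟨c, s, ⟨⟨hc, hs⟩, h⟩, rfl⟩
    exact ⟨c, hc, s, hs, h, rfl⟩
  · rintro ⟨c, hc, s, hs, h, rfl⟩
    exact ⟨c, s, ⟨⟨hc, hs⟩, h⟩, rfl⟩

theorem edgeLabels_subset : (edgeLabels S A : Set G) ⊆ H := by
  intro t ht
  obtain ⟨c, _, s, _, _, rfl⟩ := mem_edgeLabels.1 ht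
  exact out_mul_mul_out_inv_mem c s

/-- Reversing an edge inside A inverts its label. -/
theorem inv_mem_edgeLabels (hS : ∀ s ∈ S, s⁻¹ ∈ S) {t : G} (ht : t ∈ edgeLabels S A) :
    t⁻¹ ∈ edgeLabels S A := by
  obtain ⟨c, hc, s, hs, h, rfl⟩ := mem_edgeLabels.1 ht
  refine mem_edgeLabels.2 ⟨_, h, s⁻¹, hS s hs, ?_, ?_⟩
  · rwa [rightCosetMul_inv_rightCosetMul]
  · rw [rightCosetMul_inv_rightCosetMul]
    group

/-- A function that is almost invariant under the edge labels of `A` yields, together with a test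
function `f` on `A`, a function with almost the Rayleigh quotient of `f`. -/
theorem mul_sum_sq_le_sum_markovOp {f : RightCosets H → ℝ} (hf : ∀ c, 0 ≤ f c)
    (hfA : ∀ c ∉ A, f c = 0) {φ : Y → ℝ} {δ : ℝ}
    (hφT : ∀ t ∈ edgeLabels S A, ∑ y, (φ (t • y) - φ y) ^ 2 ≤ δ * ∑ y, φ y ^ 2) :
    (1 - δ / 2) * ((∑ s ∈ S, ∑ c ∈ A, f (rightCosetMul H s c) * f c) / S.card) * ∑ y, φ y ^ 2
      ≤ ∑ y, markovOp S (fun (s : G) (y : Y) => s • y)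
          (fun y => √(∑ c ∈ A, (f c * φ (c.out • y)) ^ 2)) y *
            √(∑ c ∈ A, (f c * φ (c.out • y)) ^ 2) := by
  obtain ⟨Φ, hΦ⟩ : ∃ Φ, ∑ y, φ y ^ 2 = Φ := ⟨_, rfl⟩
  rw [hΦ, sum_markovOp_mul, mul_div_assoc', div_mul_eq_mul_div, mul_sum, sum_mul]
  gcongr with s hs
  -- N(sy) N(y) dominates the inner product of the vector at sy with the vector at y shifted by c ↦
  -- cs. The shift matches c.out • s • y with (cs).out • y, two points that differ by an edge label.
  have hcs : ∀ y, ∑ c ∈ A, (f c * φ (c.out • s • y)) *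
      (f (rightCosetMul H s c) * φ ((rightCosetMul H s c).out • y)) ≤
      √(∑ c ∈ A, (f c * φ (c.out • s • y)) ^ 2) * √(∑ c ∈ A, (f c * φ (c.out • y)) ^ 2) := by
    intro y
    refine (Real.sum_mul_le_sqrt_mul_sqrt _ _ _).trans ?_
    refine mul_le_mul_of_nonneg_left (Real.sqrt_le_sqrt ?_) (Real.sqrt_nonneg _)
    exact sum_comp_rightCosetMul_le s (h := fun c => (f c * φ (c.out • y)) ^ 2)
      (fun _ => sq_nonneg _) fun c hc => by simp [hfA c hc]
  refine le_trans ?_ (sum_le_sum fun y _ => hcs y)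
  rw [sum_comm, mul_sum, sum_mul]
  refine sum_le_sum fun c hc => ?_
  subst hΦ
  set d := rightCosetMul H s c
  by_cases hd : d ∈ A
  · set t := c.out * s * d.out⁻¹ with ht
    have htT : t ∈ edgeLabels S A := mem_edgeLabels.2 ⟨c, hc, s, hs, hd, rfl⟩
    have h1 : ∑ y, φ (c.out • s • y) * φ (d.out • y) = ∑ y, φ (t • y) * φ y := by
      rw [← sum_smul_eq_sum d.out fun y => φ (t • y) * φ y]
      simp [ht, mul_smul]
    have h2 : ∑ y, (φ (t • y) - φ y) ^ 2
        = 2 * ∑ y, φ y ^ 2 - 2 * ∑ y, φ (t • y) * φ y := by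
      have e := sum_smul_eq_sum t fun y => φ y ^ 2
      rw [two_mul (∑ y, φ y ^ 2)]
      nth_rewrite 1 [← e]
      rw [mul_sum, ← sum_add_distrib, ← sum_sub_distrib]
      exact sum_congr rfl fun y _ => by ring
    have h3 := hφT t htT
    have h4 : (1 - δ / 2) * ∑ y, φ y ^ 2 ≤ ∑ y, φ (c.out • s • y) * φ (d.out • y) := by
      rw [h1]
      linarith
    calc (1 - δ / 2) * (f d * f c) * ∑ y, φ y ^ 2
        = f d * f c * ((1 - δ / 2) * ∑ y, φ y ^ 2) := by ring
      _ ≤ f d * f c * ∑ y, φ (c.out • s • y) * φ (d.out • y) :=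
          mul_le_mul_of_nonneg_left h4 (mul_nonneg (hf _) (hf _))
      _ = _ := by
          rw [mul_sum]
          exact sum_congr rfl fun y _ => by ring
  · simp [hfA d hd]

/-- Almost invariant functions have `L¹`-norm bounded below by a multiple of the `L²`-norm. -/
theorem mul_card_mul_sum_sq_le_sq_sum [Nonempty Y] {θ : ℝ}
    (hY : ∀ f : Y → ℝ, ∑ y, f y = 0 →
      ∑ y, markovOp S (fun (s : G) (y : Y) => s • y) f y * f y ≤ θ * ∑ y, f y * f y)
    {f : RightCosets H → ℝ} (hf : ∀ c, 0 ≤ f c) (hfA : ∀ c ∉ A, f c = 0)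
    {φ : Y → ℝ} (hφ : ∀ y, 0 ≤ φ y) {δ : ℝ}
    (hφT : ∀ t ∈ edgeLabels S A, ∑ y, (φ (t • y) - φ y) ^ 2 ≤ δ * ∑ y, φ y ^ 2) :
    ((1 - δ / 2) * ((∑ s ∈ S, ∑ c ∈ A, f (rightCosetMul H s c) * f c) / S.card)
        - θ * ∑ c ∈ A, f c ^ 2) * Fintype.card Y * ∑ y, φ y ^ 2
      ≤ (1 + |θ|) * (∑ c ∈ A, f c) ^ 2 * (∑ y, φ y) ^ 2 := by
  have hcard : (0 : ℝ) < Fintype.card Y := by exact_mod_cast Fintype.card_pos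
  have h1 := mul_sum_sq_le_sum_markovOp hf hfA hφT
  set N : Y → ℝ := fun y => √(∑ c ∈ A, (f c * φ (c.out • y)) ^ 2) with hN
  have h2 := h1.trans (sum_markovOp_mul_self_le_add hY N)
  have h3 : ∑ y, N y ^ 2 = (∑ c ∈ A, f c ^ 2) * ∑ y, φ y ^ 2 := by
    simp only [hN]
    rw [sum_congr rfl fun y _ => Real.sq_sqrt (sum_nonneg fun _ _ => sq_nonneg _), sum_comm,
      sum_mul]
    refine sum_congr rfl fun c _ => ?_
    simp only [mul_pow]
    rw [← mul_sum, sum_smul_eq_sum c.out fun y => φ y ^ 2]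
  -- The ℓ²-norm of a nonnegative vector is at most its ℓ¹-norm, and each translate of φ has the
  -- same sum.
  have h4 : ∑ y, N y ≤ (∑ c ∈ A, f c) * ∑ y, φ y := by
    calc ∑ y, N y ≤ ∑ y, ∑ c ∈ A, f c * φ (c.out • y) := sum_le_sum fun y _ =>
          Real.sqrt_le_iff.2 ⟨sum_nonneg fun c _ => mul_nonneg (hf c) (hφ _),
            sum_sq_le_sq_sum_of_nonneg fun c _ => mul_nonneg (hf c) (hφ _)⟩
      _ = (∑ c ∈ A, f c) * ∑ y, φ y := by
          rw [sum_comm, sum_mul]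
          exact sum_congr rfl fun c _ => by rw [← mul_sum, sum_smul_eq_sum]
  have h5 : 0 ≤ ∑ y, N y := sum_nonneg fun _ _ => Real.sqrt_nonneg _
  have h6 := pow_le_pow_left₀ h5 h4 2
  rw [h3] at h2
  have h7 : (1 + |θ|) * ((∑ y, N y) ^ 2 / Fintype.card Y) ≤
      (1 + |θ|) * (((∑ c ∈ A, f c) * ∑ y, φ y) ^ 2 / Fintype.card Y) := by gcongr
  have h8 := mul_le_mul_of_nonneg_right (h2.trans (add_le_add_right h7 _)) hcard.le
  rw [add_mul, mul_assoc (1 + |θ|), div_mul_cancel₀ _ hcard.ne'] at h8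
  linarith

end EdgeLabels

end RightCosets

/-! ### Restriction to the orbit of a subgroup -/

section Orbit

variable {G : Type*} [Group G] (L K : Subgroup G)

/-- The orbit map from `K ⧸ (L ∩ K)` to `G ⧸ L`. -/
def subgroupOfQuotientMap : K ⧸ L.subgroupOf K → G ⧸ L :=
  Quotient.map' (fun k => (k : G)) fun a b h => by
    rw [QuotientGroup.leftRel_apply] at h ⊢
    simpa [Subgroup.mem_subgroupOf] using h

theorem subgroupOfQuotientMap_smul (k : K) (x : K ⧸ L.subgroupOf K) :
    subgroupOfQuotientMap L K (k • x) = (k : G) • subgroupOfQuotientMap L K x := by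
  induction x using QuotientGroup.induction_on
  rfl

theorem subgroupOfQuotientMap_injective : Function.Injective (subgroupOfQuotientMap L K) := by
  intro x y
  induction x using QuotientGroup.induction_on
  induction y using QuotientGroup.induction_on
  intro h
  have h' := QuotientGroup.eq.1 h
  refine QuotientGroup.eq.2 ?_
  simpa [Subgroup.mem_subgroupOf] using h'

variable {L K}

/-- The image of the orbit map is K-invariant, so extension by zero commutes with K. -/
theorem extend_subgroupOfQuotientMap_smul (ψ : K ⧸ L.subgroupOf K → ℝ) (k : K) (y : G ⧸ L) :
    Function.extend (subgroupOfQuotientMap L K) ψ 0 ((k : G) • y)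
      = Function.extend (subgroupOfQuotientMap L K) (fun x => ψ (k • x)) 0 y := by
  by_cases h : y ∈ Set.range (subgroupOfQuotientMap L K)
  · obtain ⟨x, rfl⟩ := h
    rw [← subgroupOfQuotientMap_smul, (subgroupOfQuotientMap_injective L K).extend_apply,
      (subgroupOfQuotientMap_injective L K).extend_apply]
  · rw [Function.extend_apply' _ _ _ h, Function.extend_apply' _ _ _ fun ⟨x, hx⟩ =>
      h ⟨k⁻¹ • x, by rw [subgroupOfQuotientMap_smul, hx]; simp⟩]
    rfl

variable [Fintype (G ⧸ L)] [Fintype (K ⧸ L.subgroupOf K)]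

theorem sum_extend_subgroupOfQuotientMap (ψ : K ⧸ L.subgroupOf K → ℝ) :
    ∑ y, Function.extend (subgroupOfQuotientMap L K) ψ 0 y = ∑ x, ψ x :=
  (Fintype.sum_of_injective _ (subgroupOfQuotientMap_injective L K) ψ
    (Function.extend (subgroupOfQuotientMap L K) ψ 0)
    (fun _ hy => Function.extend_apply' _ _ _ hy)
    fun _ => ((subgroupOfQuotientMap_injective L K).extend_apply ..).symm).symm

/-- A lower bound for the `L¹`-norm of almost invariant functions on `G ⧸ L` passes to the orbit
`K ⧸ (L ∩ K)` of a subgroup. -/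
theorem mul_card_mul_sum_sq_le_sq_sum_of_extend {T : Finset G} {c δ : ℝ}
    (h : ∀ φ : G ⧸ L → ℝ, (∀ y, 0 ≤ φ y) →
      (∀ t ∈ T, ∑ y, (φ (t • y) - φ y) ^ 2 ≤ δ * ∑ y, φ y ^ 2) →
      c * Fintype.card (G ⧸ L) * ∑ y, φ y ^ 2 ≤ (∑ y, φ y) ^ 2)
    (hTK : (T : Set G) ⊆ K) (ψ : K ⧸ L.subgroupOf K → ℝ) (hψ : ∀ x, 0 ≤ ψ x)
    (hψT : ∀ t : K, (t : G) ∈ T → ∑ x, (ψ (t • x) - ψ x) ^ 2 ≤ δ * ∑ x, ψ x ^ 2) :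
    c * Fintype.card (G ⧸ L) * ∑ x, ψ x ^ 2 ≤ (∑ x, ψ x) ^ 2 := by
  set ι := subgroupOfQuotientMap L K
  have hι : Function.Injective ι := subgroupOfQuotientMap_injective L K
  have hext : ∀ (F : ℝ → ℝ → ℝ) (_ : F 0 0 = 0) (ψ ψ' : K ⧸ L.subgroupOf K → ℝ) (y : G ⧸ L),
      F (Function.extend ι ψ 0 y) (Function.extend ι ψ' 0 y)
        = Function.extend ι (fun x => F (ψ x) (ψ' x)) 0 y := by
    intro F hF ψ ψ' y
    by_cases hy : y ∈ Set.range ι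
    · obtain ⟨x, rfl⟩ := hy
      simp only [hι.extend_apply]
    · simp only [Function.extend_apply' _ _ _ hy, Pi.zero_apply, hF]
  have hsq : ∑ y, Function.extend ι ψ 0 y ^ 2 = ∑ x, ψ x ^ 2 := by
    rw [← sum_extend_subgroupOfQuotientMap fun x => ψ x ^ 2]
    exact sum_congr rfl fun y _ => hext (fun a _ => a ^ 2) (by norm_num) ψ ψ y
  have key := h (Function.extend ι ψ 0) (fun y => ?_) fun t ht => ?_
  · rwa [hsq, sum_extend_subgroupOfQuotientMap] at key
  · by_cases hy : y ∈ Set.range ι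
    · obtain ⟨x, rfl⟩ := hy
      rw [hι.extend_apply]
      exact hψ x
    · rw [Function.extend_apply' _ _ _ hy]
      rfl
  · rw [hsq]
    refine le_of_eq_of_le ?_ (hψT ⟨t, hTK ht⟩ ht)
    rw [← sum_extend_subgroupOfQuotientMap fun x => (ψ ((⟨t, hTK ht⟩ : K) • x) - ψ x) ^ 2]
    refine sum_congr rfl fun y _ => ?_
    have := extend_subgroupOfQuotientMap_smul ψ ⟨t, hTK ht⟩ y
    rw [this]
    exact hext (fun a b => (a - b) ^ 2) (by norm_num) _ ψ y

end Orbit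

/-! ### Uniform constants and the conclusion -/

/-- Under the spectral assumption on `H`, almost invariant functions for a suitable finite subset of
`H` on the finite quotients `Γ ⧸ L` have `L¹`-norm bounded below by their `L²`-norm, uniformly
in `L`. -/
theorem exists_forall_mul_card_mul_sum_sq_le {Γ : Type*} [Group Γ] {S : Finset Γ}
    (hS : ∀ s ∈ S, s⁻¹ ∈ S) {H : Subgroup Γ} {θ : ℝ} (hθ : θ < relSpectralRadius H S) :
    ∃ (T : Finset Γ) (c δ : ℝ), (∀ t ∈ T, t⁻¹ ∈ T) ∧ (T : Set Γ) ⊆ H ∧ 0 < c ∧ 0 < δ ∧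
      ∀ (L : Subgroup Γ) [Fintype (Γ ⧸ L)], rhoPlus L S ≤ (θ : EReal) →
      ∀ φ : Γ ⧸ L → ℝ, (∀ y, 0 ≤ φ y) →
        (∀ t ∈ T, ∑ y, (φ (t • y) - φ y) ^ 2 ≤ δ * ∑ y, φ y ^ 2) →
        c * Fintype.card (Γ ⧸ L) * ∑ y, φ y ^ 2 ≤ (∑ y, φ y) ^ 2 := by
  classical
  obtain ⟨A, f, hf, hfA, hlt⟩ := exists_finite_support_of_lt_relSpectralRadius hθ
  have hn : 0 ≤ (∑ s ∈ S, ∑ c ∈ A, f (rightCosetMul H s c) * f c) / (S.card : ℝ) :=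
    div_nonneg (sum_nonneg fun _ _ => sum_nonneg fun _ _ => mul_nonneg (hf _) (hf _))
      (Nat.cast_nonneg _)
  have hmain : ∀ (δ : ℝ) (L : Subgroup Γ) [Fintype (Γ ⧸ L)], rhoPlus L S ≤ (θ : EReal) →
      ∀ φ : Γ ⧸ L → ℝ, (∀ y, 0 ≤ φ y) →
        (∀ t ∈ edgeLabels S A, ∑ y, (φ (t • y) - φ y) ^ 2 ≤ δ * ∑ y, φ y ^ 2) → _ :=
    fun δ L _ hL φ hφ hφT => mul_card_mul_sum_sq_le_sq_sum
      (fun u hu => sum_markovOp_mul_self_le hS hL u hu) hf hfA hφ hφT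
  set n := (∑ s ∈ S, ∑ c ∈ A, f (rightCosetMul H s c) * f c) / (S.card : ℝ)
  set d := ∑ c ∈ A, f c ^ 2
  set F := ∑ c ∈ A, f c
  -- The loss δn/2 is then at most half of the gap n - θd, so β stays positive; the +1 keeps the
  -- denominator positive.
  set δ := (n - θ * d) / (n + 1) with hδ
  have hgap : 0 < n - θ * d := sub_pos.2 hlt
  have hδ0 : 0 < δ := by positivity
  have hδn : δ * n ≤ n - θ * d := by
    have : δ * (n + 1) = n - θ * d := by
      rw [hδ]
      field_simp
    linarith
  have hβ : 0 < (1 - δ / 2) * n - θ * d := by linarith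
  set β := (1 - δ / 2) * n - θ * d
  refine ⟨edgeLabels S A, β / ((1 + |θ|) * (F ^ 2 + 1)), δ, fun t => inv_mem_edgeLabels hS,
    edgeLabels_subset, by positivity, hδ0, fun L _ hL φ hφ hφT => ?_⟩
  have h := hmain δ L hL φ hφ hφT
  rw [div_mul_eq_mul_div, div_mul_eq_mul_div, div_le_iff₀ (by positivity)]
  refine h.trans ?_
  rw [mul_comm]
  gcongr
  linarith

theorem theorem4 {Γ : Type*} [Group Γ] (S : Finset Γ)
    (hSsymm : ∀ s ∈ S, s⁻¹ ∈ S) (hSgen : Subgroup.closure (S : Set Γ) = ⊤)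
    (Γs : ℕ → Subgroup Γ) (hchain : Antitone Γs) (hfin : ∀ n, (Γs n).FiniteIndex)
    (H : Subgroup Γ)
    (hH : (⨆ n, rhoPlus (Γs n) S) < (relSpectralRadius H S : EReal)) :
    ∃ H' : Subgroup Γ, H' ≤ H ∧ H'.FG ∧
      HasPropertyTau (fun n => (Γs n).subgroupOf H') ∧
      ((∀ n, (Γs n).Normal) →
        ∃ M : ℕ, 0 < M ∧ ∀ n, (H' ⊔ Γs n).index < M) := by
  classical
  -- A real θ bounds all the graphs at once, even when the supremum is -∞.
  obtain ⟨θ, hθ₁, hθ₂⟩ := EReal.lt_iff_exists_real_btwn.1 hH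
  replace hθ₂ : θ < relSpectralRadius H S := by exact_mod_cast hθ₂
  have hρ : ∀ n, rhoPlus (Γs n) S ≤ (θ : EReal) := fun n =>
    (le_iSup (fun n => rhoPlus (Γs n) S) n).trans hθ₁.le
  obtain ⟨T, c, δ, hTinv, hTH, hc, hδ, hT⟩ := exists_forall_mul_card_mul_sum_sq_le hSsymm hθ₂
  set K := Subgroup.closure (T : Set Γ) with hK
  have hTK : (T : Set Γ) ⊆ K := Subgroup.subset_closure
  have hfinK : ∀ n, ((Γs n).subgroupOf K).FiniteIndex := fun n => inferInstance
  let : ∀ n, Fintype (Γ ⧸ Γs n) := fun n => Fintype.ofFinite _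
  let : ∀ n, Fintype (K ⧸ (Γs n).subgroupOf K) := fun n => Fintype.ofFinite _
  have hbound : ∀ n (ψ : K ⧸ (Γs n).subgroupOf K → ℝ), (∀ x, 0 ≤ ψ x) →
      (∀ t : K, (t : Γ) ∈ T → ∑ x, (ψ (t • x) - ψ x) ^ 2 ≤ δ * ∑ x, ψ x ^ 2) →
      c * Fintype.card (Γ ⧸ Γs n) * ∑ x, ψ x ^ 2 ≤ (∑ x, ψ x) ^ 2 := fun n ψ hψ hψT =>
    mul_card_mul_sum_sq_le_sq_sum_of_extend (hT (Γs n) (hρ n)) hTK ψ hψ hψT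
  refine ⟨K, (Subgroup.closure_le H).2 hTH, ⟨T, rfl⟩, ⟨hfinK, T.subtype (· ∈ K), ?_, ?_, ?_⟩, ?_⟩
  · intro t ht
    rw [mem_subtype] at ht ⊢
    exact hTinv _ ht
  · convert! Subgroup.closure_closure_coe_preimage (k := (T : Set Γ))
    ext t
    simp
  · refine exists_forall_rhoPlus_le (fun i j hij => Subgroup.comap_mono (hchain hij)) ?_ hc hδ
      fun n ψ hψ hψT => le_trans ?_ (hbound n ψ hψ fun t ht => hψT t (mem_subtype.2 ht))
    · convert! Subgroup.closure_closure_coe_preimage (k := (T : Set Γ))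
      ext t
      simp
    -- The orbit embeds in Γ/Γ_n, so the bound with |Γ/Γ_n| implies the one with the orbit size. The
    -- index estimate below needs the stronger form.
    · have := Fintype.card_le_of_injective _ (subgroupOfQuotientMap_injective (Γs n) K)
      have hs : 0 ≤ ∑ x, ψ x ^ 2 := sum_nonneg fun _ _ => sq_nonneg _
      gcongr
  · intro hnormal
    refine ⟨⌊1 / c⌋₊ + 1, Nat.succ_pos _, fun n => Nat.lt_succ_of_le (Nat.le_floor ?_)⟩
    have hsum := hbound n (fun _ => 1) (fun _ => zero_le_one) fun t _ => by
      simpa using by positivity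
    simp only [one_pow, sum_const, card_univ, nsmul_eq_mul, mul_one] at hsum
    have hcK : Fintype.card (K ⧸ (Γs n).subgroupOf K) = (Γs n).relIndex K := by
      rw [← Nat.card_eq_fintype_card]
      rfl
    have hcΓ : Fintype.card (Γ ⧸ Γs n) = (Γs n).index := by
      rw [← Nat.card_eq_fintype_card]
      rfl
    -- Normality enters here, through |KΓ_n : Γ_n| = |K : K ∩ Γ_n|. Cancelling |K : K ∩ Γ_n|² in the
    -- bound for the constant 1 leaves c |Γ : KΓ_n| ≤ 1.
    have hmul : (Γs n).relIndex K * (K ⊔ Γs n).index = (Γs n).index := by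
      have := hnormal n
      rw [← Subgroup.relIndex_sup_right, Subgroup.relIndex_mul_index le_sup_right]
    have hpos : (0 : ℝ) < (Γs n).relIndex K := by
      rw [← hcK]
      exact_mod_cast Fintype.card_pos
    rw [hcK, hcΓ, ← hmul, Nat.cast_mul, sq] at hsum
    rw [le_div_iff₀ hc]
    have : (((Γs n).relIndex K : ℝ) * (c * (K ⊔ Γs n).index)) * (Γs n).relIndex K
        ≤ ((Γs n).relIndex K * 1) * (Γs n).relIndex K := by linarith
    have := le_of_mul_le_mul_left (le_of_mul_le_mul_right this hpos) hpos
    linarith
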